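/- A line arrangement $\mathcal A$ in $\mathbf P^2_{\mathbb C}$ is a finite set of lines, regarded as linear planes in $\mathbb C^3$; it is essential if these planes meet only in the origin. Let $S=\mathbb C[x,y,z]$, let $\alpha_H$ be a linear form with kernel $H\in\mathcal A$, and let $D(\mathcal A)$ be the $S$-module of all $\mathbb C$-linear derivations $\theta$ of $S$ such that $\theta(\alpha_H)\in S\alpha_H$ for all $H\in\mathcal A$. A derivation $\theta$ is homogeneous of degree $d$ if $\theta(x),\theta(y),\theta(z)$ are homogeneous polynomials of degree $d$ or zero. The arrangement $\mathcal A$ is free with exponents $(1,d_2,d_3)$ if $D(\mathcal A)$ has an $S$-basis consisting of the Euler derivation $x\partial_x+y\partial_y+z\partial_z$ and of two homogeneous derivations of degrees $d_2$ and $d_3$; it is free if this holds for some $d_2,d_3$. Let $n_2(\mathcal A)$ be the number of double points of $\mathcal A$, that is, of points of $\mathbf P^2_{\mathbb C}$ that lie on exactly two lines of $\mathcal A$. **Proposition.** There is an essential free line arrangement $\mathcal A$ in $\mathbf P^2_{\mathbb C}$ such that, for every $H\in\mathcal A$, the arrangement $\mathcal A\setminus\{H\}$ is not free and $$n_2(\mathcal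 A\setminus\{H\})<\frac{|\mathcal A|-1}{2}.$$ More precisely, the arrangement $\mathcal A$ defined by $$(x^4-y^4)(y^4-z^4)(x^4-z^4)=0$$ consists of $12$ lines, is essential, and is free with exponents $(1,5,6)$; and for every $H\in\mathcal A$ the arrangement $\mathcal A\setminus\{H\}$ of $11$ lines is essential, is not free, and satisfies $n_2(\mathcal A\setminus\{H\})=4<\frac{11}{2}$. -/

import Mathlib

/-- A line arrangement in the projective plane over `K`: a finite set of linear planes
(two-dimensional subspaces) of `K³`. -/
structure LineArrangement (K : Type*) [Field K] where
  /-- the lines of the arrangement, as planes through the origin of `K³` -/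
  lines : Set (Submodule K (Fin 3 → K))
  finite : lines.Finite
  finrank_eq : ∀ H ∈ lines, Module.finrank K H = 2

/-- The linear form `a₀ x + a₁ y + a₂ z` as a polynomial in `K[x, y, z]`. -/
noncomputable def linearFormPoly {K : Type*} [Field K] (a : Fin 3 → K) :
    MvPolynomial (Fin 3) K :=
  ∑ i, MvPolynomial.C (a i) * MvPolynomial.X i

/-- The Euler derivation `x ∂_x + y ∂_y + z ∂_z`. -/
noncomputable def eulerDerivation (K : Type*) [Field K] :
    Derivation K (MvPolynomial (Fin 3) K) (MvPolynomial (Fin 3) K) :=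
  MvPolynomial.mkDerivation K (fun i : Fin 3 => (MvPolynomial.X i : MvPolynomial (Fin 3) K))

/-- A derivation `θ` is homogeneous of degree `d` if `θ x`, `θ y`, `θ z` are homogeneous
polynomials of degree `d` (or zero). -/
def IsHomogeneousDerivation {K : Type*} [Field K]
    (θ : Derivation K (MvPolynomial (Fin 3) K) (MvPolynomial (Fin 3) K)) (d : ℕ) : Prop :=
  ∀ i : Fin 3, (θ (MvPolynomial.X i)).IsHomogeneous d

namespace LineArrangement

/-- The union of the lines of `A` is the zero locus of `Q`. -/
def IsDefinedBy {K : Type*} [Field K] (A : LineArrangement K)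
    (Q : MvPolynomial (Fin 3) K) : Prop :=
  ∀ v : Fin 3 → K, (∃ H ∈ A.lines, v ∈ H) ↔ MvPolynomial.eval v Q = 0

/-- `A` is essential: the planes of `A` meet only in the origin. -/
def IsEssential {K : Type*} [Field K] (A : LineArrangement K) : Prop :=
  sInf A.lines = ⊥

/-- The arrangement `A ∖ {H}`. -/
def delete {K : Type*} [Field K] (A : LineArrangement K)
    (H : Submodule K (Fin 3 → K)) : LineArrangement K where
  lines := A.lines \ {H}
  finite := A.finite.subset Set.sdiff_subset
  finrank_eq := fun L hL => A.finrank_eq L hL.1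

/-- The intersection lattice: all intersections of subsets of `A` (the empty intersection is the
whole space). -/
def intersectionLattice {K : Type*} [Field K] (A : LineArrangement K) :
    Set (Submodule K (Fin 3 → K)) :=
  {X | ∃ B ⊆ A.lines, X = sInf B}

/-- The points of `A`: the elements of codimension two in the intersection lattice. -/
def points {K : Type*} [Field K] (A : LineArrangement K) : Set (Submodule K (Fin 3 → K)) :=
  {p ∈ A.intersectionLattice | Module.finrank K p = 1}

/-- The Möbius function at a point: the number of lines of `A` through it, minus one. -/
noncomputable def mobius {K : Type*} [Field K] (A : LineArrangement K)
    (p : Submodule K (Fin 3 → K)) : ℤ :=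
  ({H ∈ A.lines | p ≤ H}.ncard : ℤ) - 1

/-- The number of double points of `A`. -/
noncomputable def n₂ {K : Type*} [Field K] (A : LineArrangement K) : ℕ :=
  {p ∈ A.points | A.mobius p = 1}.ncard

/-- The module `D(A)` of logarithmic vector fields: the derivations `θ` of `S = K[x, y, z]` such
that `θ α ∈ S α` for each `H ∈ A` and each linear form `α` with kernel `H` (such an `α` is
unique up to a nonzero scalar). -/
noncomputable def logDerivations {K : Type*} [Field K] (A : LineArrangement K) :
    Submodule (MvPolynomial (Fin 3) K)
      (Derivation K (MvPolynomial (Fin 3) K) (MvPolynomial (Fin 3) K)) where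
  carrier := {θ | ∀ H ∈ A.lines, ∀ a : Fin 3 → K, (∀ v, v ∈ H ↔ ∑ i, a i * v i = 0) →
    linearFormPoly a ∣ θ (linearFormPoly a)}
  zero_mem' := fun _ _ _ _ => by simp
  add_mem' := fun h₁ h₂ H hH a ha => by
    simpa using dvd_add (h₁ H hH a ha) (h₂ H hH a ha)
  smul_mem' := fun f θ h H hH a ha => by
    simpa using Dvd.dvd.mul_left (h H hH a ha) f

/-- `A` is free with exponents `(1, d₂, d₃)`: the module `D(A)` has a basis consisting of the Euler
derivation and of two homogeneous derivations of degrees `d₂` and `d₃`. -/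
def IsFreeWithExponents {K : Type*} [Field K] (A : LineArrangement K) (d₂ d₃ : ℕ) : Prop :=
  ∃ b : Module.Basis (Fin 3) (MvPolynomial (Fin 3) K) A.logDerivations,
    (b 0 : Derivation K (MvPolynomial (Fin 3) K) (MvPolynomial (Fin 3) K)) = eulerDerivation K ∧
    IsHomogeneousDerivation (b 1 : Derivation K _ _) d₂ ∧
    IsHomogeneousDerivation (b 2 : Derivation K _ _) d₃

/-- `A` is free (with some exponents). -/
def IsFree {K : Type*} [Field K] (A : LineArrangement K) : Prop :=
  ∃ d₂ d₃ : ℕ, A.IsFreeWithExponents d₂ d₃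

end LineArrangement

/-! Each of the twelve lines `x_i = ζ x_j` (`ζ ^ 4 = 1`) carries one quadruple point, a coordinate
point, and four triple points; the arrangement has no double points. Deleting a line turns its four
triple points into double points and creates no others, which gives the count 4.

Freeness is Saito's criterion: the Euler field, `∑ x_c⁵ ∂_c` and `∑ (x_{c+1} x_{c+2})³ ∂_c` are
logarithmic, and the determinant of their coefficients is, up to sign, the defining polynomial `Q`
of degree 12. Any three logarithmic fields have determinant divisible by `Q`, so Cramer's rule
writes every logarithmic field in terms of these three.

For a deletion `A'` of `A` along `H`, the main point is `lineForm_dvd_of_mem_delete`: a field in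
`D(A')` of degree at most 5 is already in `D(A)`. Its contraction with the form of `H`, restricted
to `H`, has six zeros counted with multiplicity, two at the quadruple point and one at each triple
point. If `D(A')` were free with exponents `(1, d₂, d₃)`, comparing determinants for `D(A) ⊆ D(A')`
would give `d₂ + d₃ ≤ 11`. Since `D(A)` has only multiples of the Euler field up to degree 4, both
exponents are at least 5. If the sum is 10, the whole basis lies in `D(A)`; if it is 11, the change
of basis is invertible. Either way `D(A') = D(A)`, which an explicit field refutes. -/

open MvPolynomial

/-! ### Lines `x_i = ζ x_j` and their coincidences -/

/-- The line `x_i = ζ x_j`. -/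
noncomputable def fermatLine (i j : Fin 3) (ζ : ℂ) : Submodule ℂ (Fin 3 → ℂ) :=
  LinearMap.ker (LinearMap.proj i - ζ • LinearMap.proj j : (Fin 3 → ℂ) →ₗ[ℂ] ℂ)

theorem mem_fermatLine {i j : Fin 3} {ζ : ℂ} {v : Fin 3 → ℂ} :
    v ∈ fermatLine i j ζ ↔ v i = ζ * v j := by
  simp [fermatLine, sub_eq_zero]

theorem exists_eq_I_pow {ζ : ℂ} (h : ζ ^ 4 = 1) : ∃ n : Fin 4, ζ = Complex.I ^ (n : ℕ) := by
  have h' : (ζ - 1) * (ζ + 1) * ((ζ - Complex.I) * (ζ + Complex.I)) = 0 := by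
    linear_combination h + (1 - ζ ^ 2) * Complex.I_sq
  rcases mul_eq_zero.1 h' with h' | h' <;> rcases mul_eq_zero.1 h' with h' | h'
  · exact ⟨0, by simpa using sub_eq_zero.1 h'⟩
  · exact ⟨2, by simpa using eq_neg_of_add_eq_zero_left h'⟩
  · exact ⟨1, by simpa using sub_eq_zero.1 h'⟩
  · exact ⟨3, by simpa using eq_neg_of_add_eq_zero_left h'⟩

theorem I_pow_injective : Function.Injective fun n : Fin 4 => Complex.I ^ (n : ℕ) := by
  intro m n h
  have h1 := congrArg Complex.re h
  have h2 := congrArg Complex.im h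
  fin_cases m <;> fin_cases n <;> first | rfl | (exfalso; revert h1 h2; norm_num)

theorem I_pow_pow_four (n : ℕ) : (Complex.I ^ n) ^ 4 = 1 := by
  rw [← pow_mul, mul_comm, pow_mul, Complex.I_pow_four, one_pow]

theorem ne_zero_of_pow_four_eq_one {ζ : ℂ} (h : ζ ^ 4 = 1) : ζ ≠ 0 := by
  rintro rfl
  norm_num at h

theorem exists_root_of_pow_four_eq {a b : ℂ} (h : a ^ 4 = b ^ 4) :
    ∃ ω : ℂ, ω ^ 4 = 1 ∧ a = ω * b := by
  by_cases hb : b = 0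
  · exact ⟨1, by simp, by simpa [hb] using h⟩
  · exact ⟨a / b, by rw [div_pow, h, div_self (pow_ne_zero 4 hb)], by field_simp⟩

/-- `ζ ^ 3` is the inverse of `ζ`; using the power avoids division in the later computations. -/
theorem fermatLine_symm {i j : Fin 3} {ζ : ℂ} (h : ζ ^ 4 = 1) :
    fermatLine i j ζ = fermatLine j i (ζ ^ 3) := by
  ext v
  rw [mem_fermatLine, mem_fermatLine]
  constructor <;> intro e <;> rw [e]
  · linear_combination (-v j) * h
  · linear_combination (-v i) * h

theorem fermatLine_injective {i j : Fin 3} (hij : i ≠ j) :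
    Function.Injective (fermatLine i j) := by
  intro ζ ω h
  have : (Function.update (fun _ => 1) i ζ : Fin 3 → ℂ) ∈ fermatLine i j ω := by
    rw [← h, mem_fermatLine]
    simp [hij.symm]
  simpa [mem_fermatLine, hij.symm] using this

/-- Lines joining different pairs of coordinate points are different. -/
theorem fermatLine_ne {i j k : Fin 3} (hik : i ≠ k) (hjk : j ≠ k) {a : Fin 3}
    {ζ ω : ℂ} (hω : ω ≠ 0) (ha : a ≠ k) :
    fermatLine i j ζ ≠ fermatLine a k ω := by
  intro h
  have : (Pi.single k 1 : Fin 3 → ℂ) ∈ fermatLine a k ω := by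
    rw [← h, mem_fermatLine]
    simp [hik, hjk]
  rw [mem_fermatLine] at this
  simp [ha, hω.symm] at this

theorem finrank_fermatLine {i j : Fin 3} (hij : i ≠ j) (ζ : ℂ) :
    Module.finrank ℂ (fermatLine i j ζ) = 2 := by
  have h := LinearMap.finrank_range_add_finrank_ker
    (LinearMap.proj i - ζ • LinearMap.proj j : (Fin 3 → ℂ) →ₗ[ℂ] ℂ)
  have hs : LinearMap.range (LinearMap.proj i - ζ • LinearMap.proj j : (Fin 3 → ℂ) →ₗ[ℂ] ℂ) = ⊤ :=
    LinearMap.range_eq_top.2 fun c => ⟨Pi.single i c, by simp [hij.symm]⟩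
  rw [hs, finrank_top, Module.finrank_self, Module.finrank_fin_fun] at h
  unfold fermatLine
  omega

/-- The lines `x_i = ζ x_{i+1}`, `ζ` a fourth root of unity. -/
noncomputable def cyclicLine (p : Fin 3 × Fin 4) : Submodule ℂ (Fin 3 → ℂ) :=
  fermatLine p.1 (p.1 + 1) (Complex.I ^ (p.2 : ℕ))

theorem cyclicLine_injective : Function.Injective cyclicLine := by
  rintro ⟨i, m⟩ ⟨j, n⟩ h
  have hI : ∀ n : ℕ, Complex.I ^ n ≠ 0 := fun n => pow_ne_zero n Complex.I_ne_zero
  have hs : ∀ a : Fin 3, a ≠ a + 1 := by decide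
  by_cases hij : i = j
  · subst hij
    exact Prod.ext rfl (I_pow_injective (fermatLine_injective (hs i) h))
  · exfalso
    -- Two different cyclic pairs: one of `j + 1`, `j` is missing from `{i, i + 1}`, and the
    -- coordinate point at that index lies on the first line but not on the second.
    have hc : (i ≠ j + 1 ∧ i + 1 ≠ j + 1) ∨ (i ≠ j ∧ i + 1 ≠ j) := by
      clear h
      revert i j
      decide
    rcases hc with ⟨h1, h2⟩ | ⟨h1, h2⟩
    · exact fermatLine_ne h1 h2 (hI n) (hs j) h
    · have h' : cyclicLine (i, m) = fermatLine (j + 1) j ((Complex.I ^ (n : ℕ)) ^ 3) := by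
        rw [← fermatLine_symm (I_pow_pow_four n), h, cyclicLine]
      exact fermatLine_ne h1 h2 (pow_ne_zero 3 (hI n)) (hs j).symm h'

theorem mem_range_cyclicLine {L : Submodule ℂ (Fin 3 → ℂ)} :
    L ∈ Set.range cyclicLine ↔ ∃ i j ζ, i ≠ j ∧ ζ ^ 4 = 1 ∧ L = fermatLine i j ζ := by
  constructor
  · rintro ⟨⟨i, n⟩, rfl⟩
    exact ⟨i, i + 1, _, by fin_cases i <;> decide, I_pow_pow_four n, rfl⟩
  · rintro ⟨i, j, ζ, hij, hζ, rfl⟩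
    rcases (by revert i j; decide : j = i + 1 ∨ i = j + 1) with rfl | rfl
    · obtain ⟨n, rfl⟩ := exists_eq_I_pow hζ
      exact ⟨(i, n), rfl⟩
    · rw [fermatLine_symm hζ]
      have h3 : (ζ ^ 3) ^ 4 = 1 := by rw [← pow_mul, mul_comm, pow_mul, hζ, one_pow]
      obtain ⟨n, hn⟩ := exists_eq_I_pow h3
      exact ⟨(j, n), by rw [cyclicLine, hn]⟩

/-! ### The arrangement and its defining equation -/

/-- The arrangement `(x⁴ - y⁴)(y⁴ - z⁴)(x⁴ - z⁴) = 0`. -/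
noncomputable def fermatArrangement : LineArrangement ℂ where
  lines := Set.range cyclicLine
  finite := Set.finite_range _
  finrank_eq := by
    intro L hL
    obtain ⟨i, j, ζ, hij, -, rfl⟩ := mem_range_cyclicLine.1 hL
    exact finrank_fermatLine hij ζ

theorem mem_fermatArrangement {L : Submodule ℂ (Fin 3 → ℂ)} :
    L ∈ fermatArrangement.lines ↔ ∃ i j ζ, i ≠ j ∧ ζ ^ 4 = 1 ∧ L = fermatLine i j ζ :=
  mem_range_cyclicLine

theorem ncard_fermatArrangement : fermatArrangement.lines.ncard = 12 := by
  change (Set.range cyclicLine).ncard = 12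
  rw [← Set.image_univ, Set.ncard_image_of_injective _ cyclicLine_injective, Set.ncard_univ]
  simp

theorem fermatArrangement_isDefinedBy :
    fermatArrangement.IsDefinedBy
      ((X 0 ^ 4 - X 1 ^ 4) * (X 1 ^ 4 - X 2 ^ 4) * (X 0 ^ 4 - X 2 ^ 4)) := by
  intro v
  have key : (∃ H ∈ fermatArrangement.lines, v ∈ H) ↔ ∃ i j, i ≠ j ∧ v i ^ 4 = v j ^ 4 := by
    constructor
    · rintro ⟨H, hH, hv⟩
      obtain ⟨i, j, ζ, hij, hζ, rfl⟩ := mem_fermatArrangement.1 hH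
      exact ⟨i, j, hij, by rw [mem_fermatLine.1 hv, mul_pow, hζ, one_mul]⟩
    · rintro ⟨i, j, hij, h⟩
      obtain ⟨ω, hω, e⟩ := exists_root_of_pow_four_eq h
      exact ⟨_, mem_fermatArrangement.2 ⟨i, j, ω, hij, hω, rfl⟩, mem_fermatLine.2 e⟩
  rw [key]
  simp only [map_mul, map_sub, map_pow, eval_X, mul_eq_zero, sub_eq_zero]
  constructor
  · rintro ⟨i, j, hij, h⟩
    fin_cases i <;> fin_cases j <;> simp_all
  · rintro ((h | h) | h)
    exacts [⟨0, 1, by decide, h⟩, ⟨1, 2, by decide, h⟩, ⟨0, 2, by decide, h⟩]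

theorem mem_delete {L H : Submodule ℂ (Fin 3 → ℂ)} :
    L ∈ (fermatArrangement.delete H).lines ↔ L ∈ fermatArrangement.lines ∧ L ≠ H :=
  Iff.rfl

/-! ### Lines of a deletion, and essentiality -/

section
variable {i j k : Fin 3} {ζ : ℂ}

theorem fermatLine_mem_delete_left (hik : i ≠ k) (hjk : j ≠ k) {ω : ℂ}
    (hω : ω ^ 4 = 1) :
    fermatLine i k ω ∈ (fermatArrangement.delete (fermatLine i j ζ)).lines :=
  mem_delete.2 ⟨mem_fermatArrangement.2 ⟨i, k, ω, hik, hω, rfl⟩,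
    (fermatLine_ne hik hjk (ne_zero_of_pow_four_eq_one hω) hik).symm⟩

theorem fermatLine_mem_delete_right (hik : i ≠ k) (hjk : j ≠ k) {ω : ℂ}
    (hω : ω ^ 4 = 1) :
    fermatLine j k ω ∈ (fermatArrangement.delete (fermatLine i j ζ)).lines :=
  mem_delete.2 ⟨mem_fermatArrangement.2 ⟨j, k, ω, hjk, hω, rfl⟩,
    (fermatLine_ne hik hjk (ne_zero_of_pow_four_eq_one hω) hjk).symm⟩

theorem fermatLine_mem_delete_same (hij : i ≠ j) {ω : ℂ} (hω : ω ^ 4 = 1) (hne : ω ≠ ζ) :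
    fermatLine i j ω ∈ (fermatArrangement.delete (fermatLine i j ζ)).lines :=
  mem_delete.2 ⟨mem_fermatArrangement.2 ⟨i, j, ω, hij, hω, rfl⟩,
    fun h => hne (fermatLine_injective hij h)⟩

/-- The lines of the deletion of `x_i = ζ x_j`. -/
theorem mem_delete_fermatLine (hij : i ≠ j) (hik : i ≠ k) (hjk : j ≠ k)
    {L : Submodule ℂ (Fin 3 → ℂ)} :
    L ∈ (fermatArrangement.delete (fermatLine i j ζ)).lines ↔
      ∃ ω : ℂ, ω ^ 4 = 1 ∧ (L = fermatLine i j ω ∧ ω ≠ ζ ∨ L = fermatLine i k ω ∨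
        L = fermatLine j k ω) := by
  constructor
  · rintro ⟨hL, hne⟩
    obtain ⟨a, b, ω, hab, hω, rfl⟩ := mem_fermatArrangement.1 hL
    have h3 : (ω ^ 3) ^ 4 = 1 := by rw [← pow_mul, mul_comm, pow_mul, hω, one_pow]
    have h : (a = i ∧ b = j ∨ a = i ∧ b = k ∨ a = j ∧ b = k) ∨
        (b = i ∧ a = j ∨ b = i ∧ a = k ∨ b = j ∧ a = k) := by
      clear hne hL
      revert i j k a b
      decide
    rcases h with h | h
    · refine ⟨ω, hω, ?_⟩
      rcases h with ⟨rfl, rfl⟩ | ⟨rfl, rfl⟩ | ⟨rfl, rfl⟩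
      · exact Or.inl ⟨rfl, by rintro rfl; exact hne rfl⟩
      · exact Or.inr (Or.inl rfl)
      · exact Or.inr (Or.inr rfl)
    · rw [fermatLine_symm hω] at hne ⊢
      refine ⟨ω ^ 3, h3, ?_⟩
      rcases h with ⟨rfl, rfl⟩ | ⟨rfl, rfl⟩ | ⟨rfl, rfl⟩
      · exact Or.inl ⟨rfl, fun e => hne (by rw [e]; rfl)⟩
      · exact Or.inr (Or.inl rfl)
      · exact Or.inr (Or.inr rfl)
  · rintro ⟨ω, hω, ⟨rfl, h⟩ | rfl | rfl⟩
    · exact fermatLine_mem_delete_same hij hω h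
    · exact fermatLine_mem_delete_left hik hjk hω
    · exact fermatLine_mem_delete_right hik hjk hω

/-- The lines `x_i = x_k`, `x_i = -x_k` and `x_j = x_k` survive the deletion and already meet only
in the origin. -/
theorem delete_isEssential (hij : i ≠ j) (hik : i ≠ k) (hjk : j ≠ k) :
    (fermatArrangement.delete (fermatLine i j ζ)).IsEssential := by
  rw [LineArrangement.IsEssential, eq_bot_iff]
  intro v hv
  rw [Submodule.mem_sInf] at hv
  have h1 := mem_fermatLine.1 (hv _ (fermatLine_mem_delete_left hik hjk (one_pow 4)))
  have h2 := mem_fermatLine.1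
    (hv _ (fermatLine_mem_delete_left hik hjk (ω := -1) (by norm_num)))
  have h3 := mem_fermatLine.1 (hv _ (fermatLine_mem_delete_right hik hjk (one_pow 4)))
  have hk : v k = 0 := by linear_combination (h2 - h1) / 2
  rw [Submodule.mem_bot]
  funext a
  rcases (by clear hv h1 h2 h3 hk; revert i j k a; decide : a = i ∨ a = j ∨ a = k)
    with rfl | rfl | rfl <;> simp [h1, h3, hk]

end

theorem fermatArrangement_isEssential : fermatArrangement.IsEssential :=
  eq_bot_iff.2 ((sInf_le_sInf Set.sdiff_subset).trans
    (delete_isEssential (i := 0) (j := 1) (k := 2) (ζ := 1)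
      (by decide) (by decide) (by decide)).le)

section
variable {i j k : Fin 3} {ζ : ℂ}

theorem ncard_delete {H : Submodule ℂ (Fin 3 → ℂ)} (hH : H ∈ fermatArrangement.lines) :
    (fermatArrangement.delete H).lines.ncard = 11 := by
  change (fermatArrangement.lines \ {H}).ncard = 11
  rw [Set.ncard_sdiff_singleton_of_mem hH, ncard_fermatArrangement]

/-! ### Double points of a deletion -/

/-- The point with coordinates `ζ`, `1` at `i`, `j` and `ω` at the third place. -/
def pointOnLine (i j : Fin 3) (ζ ω : ℂ) : Fin 3 → ℂ :=
  fun a => if a = i then ζ else if a = j then 1 else ω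

theorem pointOnLine_left (ω : ℂ) : pointOnLine i j ζ ω i = ζ := by simp [pointOnLine]

theorem pointOnLine_mid (hij : i ≠ j) (ω : ℂ) : pointOnLine i j ζ ω j = 1 := by
  simp [pointOnLine, hij.symm]

theorem pointOnLine_right (hik : i ≠ k) (hjk : j ≠ k) (ω : ℂ) : pointOnLine i j ζ ω k = ω := by
  simp [pointOnLine, hik.symm, hjk.symm]

theorem eq_or_eq_or_eq (hij : i ≠ j) (hik : i ≠ k) (hjk : j ≠ k) (a : Fin 3) :
    a = i ∨ a = j ∨ a = k := by
  revert i j k a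
  decide

/-- The double points of the deletion of the line `x_i = ζ x_j` are its triple points on that
line. -/
theorem doublePoints_delete (hij : i ≠ j) (hik : i ≠ k) (hjk : j ≠ k) (hζ : ζ ^ 4 = 1) :
    {p ∈ (fermatArrangement.delete (fermatLine i j ζ)).points |
      (fermatArrangement.delete (fermatLine i j ζ)).mobius p = 1} =
      Set.range fun n : Fin 4 =>
        Submodule.span ℂ {pointOnLine i j ζ (Complex.I ^ (n : ℕ))} := by
  ext p
  constructor
  · rintro ⟨⟨-, hp⟩, hm⟩
    obtain ⟨w, -, hw⟩ := finrank_eq_one_iff'.1 hp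
    obtain ⟨v, hvp⟩ := w
    have hpv : p = Submodule.span ℂ {v} := by
      refine le_antisymm (fun u hu => ?_) ?_
      · obtain ⟨c, hc⟩ := hw ⟨u, hu⟩
        exact Submodule.mem_span_singleton.2 ⟨c, congrArg Subtype.val hc⟩
      · rw [Submodule.span_singleton_le_iff_mem]
        exact hvp
    have hm' : {H ∈ (fermatArrangement.delete (fermatLine i j ζ)).lines | p ≤ H}.ncard = 2 := by
      unfold LineArrangement.mobius at hm
      omega
    obtain ⟨L₁, L₂, hne, hS⟩ := Set.ncard_eq_two.1 hm'
    have hmem : ∀ L, L ∈ (fermatArrangement.delete (fermatLine i j ζ)).lines → v ∈ L →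
        L = L₁ ∨ L = L₂ := by
      intro L hL hvL
      have : L ∈ ({L₁, L₂} : Set _) := hS ▸
        (⟨hL, by rw [hpv, Submodule.span_singleton_le_iff_mem]; exact hvL⟩ : L ∈ {H ∈ _ | p ≤ H})
      simpa using this
    have hthree : ∀ A B C, A ∈ (fermatArrangement.delete (fermatLine i j ζ)).lines →
        B ∈ (fermatArrangement.delete (fermatLine i j ζ)).lines →
        C ∈ (fermatArrangement.delete (fermatLine i j ζ)).lines →
        v ∈ A → v ∈ B → v ∈ C → A ≠ B → A ≠ C → B ≠ C → False := by
      intro A B C hA hB hC vA vB vC hAB hAC hBC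
      rcases hmem A hA vA with rfl | rfl <;> rcases hmem B hB vB with rfl | rfl <;>
        rcases hmem C hC vC with rfl | rfl <;> first | exact hAB rfl | exact hAC rfl | exact hBC rfl
    have hI : Complex.I ^ 4 = 1 := Complex.I_pow_four
    have hI1 : Complex.I ≠ 1 := fun h => by simpa using congrArg Complex.im h
    have hI2 : Complex.I ≠ -1 := fun h => by simpa using congrArg Complex.im h
    have h12 : (1 : ℂ) ≠ -1 := by norm_num
    have hm4 : (-1 : ℂ) ^ 4 = 1 := by norm_num
    have hζ0 := ne_zero_of_pow_four_eq_one hζ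
    -- The point is not a coordinate point: at least three lines of the deletion pass through each
    -- of these. Here the pencil has lost the line with parameter `ζ`, so the parameters `cζ` with
    -- `c = I, -1, -I` are used.
    have hzij : ¬ (v i = 0 ∧ v j = 0) := by
      rintro ⟨h1, h2⟩
      have hv : ∀ ω, v ∈ fermatLine i j ω := fun ω => mem_fermatLine.2 (by simp [h1, h2])
      have hd : ∀ c : ℂ, c ^ 4 = 1 → c ≠ 1 →
          fermatLine i j (c * ζ) ∈ (fermatArrangement.delete (fermatLine i j ζ)).lines :=
        fun c hc h => fermatLine_mem_delete_same hij (by rw [mul_pow, hc, hζ, one_mul])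
          fun e => h (mul_right_cancel₀ hζ0 (e.trans (one_mul ζ).symm))
      have hn : ∀ c d : ℂ, c ≠ d → fermatLine i j (c * ζ) ≠ fermatLine i j (d * ζ) :=
        fun c d h e => h (mul_right_cancel₀ hζ0 (fermatLine_injective hij e))
      have hI3 : -Complex.I ≠ 1 := fun h => hI2 (neg_eq_iff_eq_neg.1 h)
      have hI4 : -Complex.I ≠ -1 := fun h => hI1 (neg_injective h)
      have hI5 : -Complex.I ≠ Complex.I := fun h => by
        have := congrArg Complex.im h
        norm_num at this
      exact hthree _ _ _ (hd _ hI hI1) (hd _ hm4 h12.symm)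
        (hd (-Complex.I) (by rw [Even.neg_pow (by decide), hI]) hI3) (hv _) (hv _) (hv _)
        (hn _ _ hI2) (hn _ _ hI5.symm) (hn _ _ hI4.symm)
    have hzik : ¬ (v i = 0 ∧ v k = 0) := by
      rintro ⟨h1, h2⟩
      have hv : ∀ ω, v ∈ fermatLine i k ω := fun ω => mem_fermatLine.2 (by simp [h1, h2])
      have hn : ∀ c d : ℂ, c ≠ d → fermatLine i k c ≠ fermatLine i k d :=
        fun c d h => (fermatLine_injective hik).ne h
      exact hthree _ _ _ (fermatLine_mem_delete_left hik hjk hI)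
        (fermatLine_mem_delete_left hik hjk hm4)
        (fermatLine_mem_delete_left hik hjk (one_pow 4)) (hv _) (hv _) (hv _)
        (hn _ _ hI2) (hn _ _ hI1) (hn _ _ h12.symm)
    have hzjk : ¬ (v j = 0 ∧ v k = 0) := by
      rintro ⟨h1, h2⟩
      have hv : ∀ ω, v ∈ fermatLine j k ω := fun ω => mem_fermatLine.2 (by simp [h1, h2])
      have hn : ∀ c d : ℂ, c ≠ d → fermatLine j k c ≠ fermatLine j k d :=
        fun c d h => (fermatLine_injective hjk).ne h
      exact hthree _ _ _ (fermatLine_mem_delete_right hik hjk hI)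
        (fermatLine_mem_delete_right hik hjk hm4)
        (fermatLine_mem_delete_right hik hjk (one_pow 4)) (hv _) (hv _) (hv _)
        (hn _ _ hI2) (hn _ _ hI1) (hn _ _ h12.symm)
    have hsame : ∀ {a b : Fin 3} {ω₁ ω₂ : ℂ}, ¬ (v a = 0 ∧ v b = 0) → v ∈ fermatLine a b ω₁ →
        v ∈ fermatLine a b ω₂ → ω₁ = ω₂ := by
      intro a b ω₁ ω₂ h h1 h2
      rw [mem_fermatLine] at h1 h2
      by_contra hω
      have h3 : (ω₁ - ω₂) * v b = 0 := by linear_combination h2 - h1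
      have h4 : v b = 0 := (mul_eq_zero.1 h3).resolve_left (sub_ne_zero.2 hω)
      exact h ⟨by rw [h1, h4, mul_zero], h4⟩
    have hpow : ∀ {a b : Fin 3} {ω : ℂ}, ω ^ 4 = 1 → v ∈ fermatLine a b ω →
        v a ^ 4 = v b ^ 4 := by
      intro a b ω hω h
      rw [mem_fermatLine.1 h, mul_pow, hω, one_mul]
    have hL : ∀ L, (L = L₁ ∨ L = L₂) →
        L ∈ (fermatArrangement.delete (fermatLine i j ζ)).lines ∧ v ∈ L := by
      intro L h
      have : L ∈ ({L₁, L₂} : Set _) := by simpa using h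
      rw [← hS] at this
      exact ⟨this.1, this.2 hvp⟩
    obtain ⟨hL₁, hv₁⟩ := hL L₁ (Or.inl rfl)
    obtain ⟨hL₂, hv₂⟩ := hL L₂ (Or.inr rfl)
    -- Two lines of one pencil meet only at a coordinate point, so the two lines come from different
    -- pencils, and their equations make all three fourth powers equal.
    have h4 : v i ^ 4 = v j ^ 4 ∧ v k ^ 4 = v j ^ 4 := by
      obtain ⟨ω₁, hω₁, h₁⟩ := (mem_delete_fermatLine hij hik hjk).1 hL₁
      obtain ⟨ω₂, hω₂, h₂⟩ := (mem_delete_fermatLine hij hik hjk).1 hL₂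
      rcases h₁ with ⟨rfl, -⟩ | rfl | rfl <;> rcases h₂ with ⟨rfl, -⟩ | rfl | rfl <;>
        have e₁ := hpow hω₁ hv₁ <;> have e₂ := hpow hω₂ hv₂
      · exact (hne (by rw [hsame hzij hv₁ hv₂])).elim
      · exact ⟨e₁, e₂.symm.trans e₁⟩
      · exact ⟨e₁, e₂.symm⟩
      · exact ⟨e₂, e₁.symm.trans e₂⟩
      · exact (hne (by rw [hsame hzik hv₁ hv₂])).elim
      · exact ⟨e₁.trans e₂.symm, e₂.symm⟩
      · exact ⟨e₂, e₁.symm⟩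
      · exact ⟨e₂.trans e₁.symm, e₁.symm⟩
      · exact (hne (by rw [hsame hzjk hv₁ hv₂])).elim
    obtain ⟨a, ha, hia⟩ := exists_root_of_pow_four_eq h4.1
    obtain ⟨b, hb, hib⟩ := exists_root_of_pow_four_eq (h4.1.trans h4.2.symm)
    obtain ⟨c, hc, hjc⟩ := exists_root_of_pow_four_eq h4.2.symm
    obtain ⟨d, hd, hkd⟩ := exists_root_of_pow_four_eq h4.2
    -- The point now lies on one line of each pencil in the full arrangement. Unless the first of
    -- them is the deleted line, three lines remain through it.
    have haζ : a = ζ := by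
      by_contra hne'
      refine hthree _ _ _ (fermatLine_mem_delete_same hij ha hne')
        (fermatLine_mem_delete_left hik hjk hb) (fermatLine_mem_delete_right hik hjk hc)
        (mem_fermatLine.2 hia) (mem_fermatLine.2 hib) (mem_fermatLine.2 hjc)
        (fermatLine_ne hik hjk (ne_zero_of_pow_four_eq_one hb) hik)
        (fermatLine_ne hik hjk (ne_zero_of_pow_four_eq_one hc) hjk) ?_
      rw [fermatLine_symm hc]
      exact fermatLine_ne hij hjk.symm (pow_ne_zero 3 (ne_zero_of_pow_four_eq_one hc)) hjk.symm
    subst haζ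
    have hvj : v j ≠ 0 := fun h => hzij ⟨by rw [hia, h, mul_zero], h⟩
    obtain ⟨n, rfl⟩ := exists_eq_I_pow hd
    refine ⟨n, ?_⟩
    have : v = v j • pointOnLine i j a (Complex.I ^ (n : ℕ)) := by
      funext x
      rcases eq_or_eq_or_eq hij hik hjk x with rfl | rfl | rfl
      · rw [Pi.smul_apply, pointOnLine_left, hia, smul_eq_mul, mul_comm]
      · rw [Pi.smul_apply, pointOnLine_mid hij, smul_eq_mul, mul_one]
      · rw [Pi.smul_apply, pointOnLine_right hik hjk, hkd, smul_eq_mul, mul_comm]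
    change Submodule.span ℂ _ = p
    rw [hpv]
    conv_rhs => rw [this]
    exact (Submodule.span_singleton_smul_eq (IsUnit.mk0 _ hvj) _).symm
  · rintro ⟨n, rfl⟩
    have hω := I_pow_pow_four n
    change Submodule.span ℂ {pointOnLine i j ζ (Complex.I ^ (n : ℕ))} ∈ _
    generalize Complex.I ^ (n : ℕ) = ω at hω ⊢
    have hω3 : (ω ^ 3) ^ 4 = 1 := by rw [← pow_mul, mul_comm, pow_mul, hω, one_pow]
    have hζω : (ζ * ω ^ 3) ^ 4 = 1 := by rw [mul_pow, hζ, hω3, one_mul]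
    have hi := pointOnLine_left (i := i) (j := j) (ζ := ζ) ω
    have hj := pointOnLine_mid (ζ := ζ) hij ω
    have hk := pointOnLine_right (ζ := ζ) hik hjk ω
    -- With `ω ^ 3 = ω⁻¹`, these are the lines `x_i = (ζ/ω) x_k` and `x_j = ω⁻¹ x_k`, the two that
    -- remain at the former triple point `(ζ, 1, ω)`.
    have hm₁ := fermatLine_mem_delete_left (ζ := ζ) hik hjk hζω
    have hm₂ := fermatLine_mem_delete_right (ζ := ζ) hik hjk hω3
    have hv0 : pointOnLine i j ζ ω ≠ 0 := fun h => by
      rw [h] at hj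
      simp at hj
    refine ⟨⟨⟨{fermatLine i k (ζ * ω ^ 3), fermatLine j k (ω ^ 3)}, ?_, ?_⟩, ?_⟩, ?_⟩
    · rintro L (rfl | rfl)
      exacts [hm₁, hm₂]
    · rw [sInf_pair]
      ext u
      rw [Submodule.mem_inf, mem_fermatLine, mem_fermatLine, Submodule.mem_span_singleton]
      constructor
      · rintro ⟨c, rfl⟩
        simp only [Pi.smul_apply, hi, hj, hk, smul_eq_mul]
        exact ⟨by linear_combination (-c * ζ) * hω, by linear_combination (-c) * hω⟩
      · rintro ⟨h1, h2⟩
        refine ⟨ω ^ 3 * u k, ?_⟩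
        funext x
        rcases eq_or_eq_or_eq hij hik hjk x with rfl | rfl | rfl <;>
          simp only [Pi.smul_apply, hi, hj, hk, smul_eq_mul]
        · linear_combination -h1
        · linear_combination -h2
        · linear_combination (u x) * hω
    · exact finrank_span_singleton hv0
    · have hS : {H ∈ (fermatArrangement.delete (fermatLine i j ζ)).lines |
          Submodule.span ℂ {pointOnLine i j ζ ω} ≤ H} =
          {fermatLine i k (ζ * ω ^ 3), fermatLine j k (ω ^ 3)} := by
        ext L
        simp only [Set.mem_ofPred_eq, Submodule.span_singleton_le_iff_mem, Set.mem_insert_iff,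
          Set.mem_singleton_iff]
        constructor
        · rintro ⟨hL, hv⟩
          obtain ⟨c, hc, ⟨rfl, h⟩ | rfl | rfl⟩ := (mem_delete_fermatLine hij hik hjk).1 hL
          · rw [mem_fermatLine, hi, hj, mul_one] at hv
            exact (h hv.symm).elim
          · rw [mem_fermatLine, hi, hk] at hv
            left
            congr 1
            rw [hv]
            linear_combination (-c) * hω
          · rw [mem_fermatLine, hj, hk] at hv
            right
            congr 1
            linear_combination (-c) * hω - ω ^ 3 * hv
        · rintro (rfl | rfl)
          · exact ⟨hm₁, by rw [mem_fermatLine, hi, hk]; linear_combination (-ζ) * hω⟩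
          · exact ⟨hm₂, by rw [mem_fermatLine, hj, hk]; linear_combination -hω⟩
      have hne : fermatLine i k (ζ * ω ^ 3) ≠ fermatLine j k (ω ^ 3) := by
        rw [fermatLine_symm hω3]
        exact fermatLine_ne hij hjk.symm
          (pow_ne_zero 3 (ne_zero_of_pow_four_eq_one hω3)) hjk.symm
      rw [LineArrangement.mobius, hS, Set.ncard_pair hne]
      norm_num

theorem n₂_delete (hij : i ≠ j) (hik : i ≠ k) (hjk : j ≠ k) (hζ : ζ ^ 4 = 1) :
    (fermatArrangement.delete (fermatLine i j ζ)).n₂ = 4 := by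
  rw [LineArrangement.n₂, doublePoints_delete hij hik hjk hζ, ← Set.image_univ,
    Set.ncard_image_of_injective, Set.ncard_univ]
  · simp
  · intro m n h
    apply I_pow_injective
    have h' : pointOnLine i j ζ (Complex.I ^ (m : ℕ)) ∈
        Submodule.span ℂ {pointOnLine i j ζ (Complex.I ^ (n : ℕ))} := by
      rw [← show Submodule.span ℂ _ = Submodule.span ℂ _ from h]
      exact Submodule.mem_span_singleton_self _
    obtain ⟨c, hc⟩ := Submodule.mem_span_singleton.1 h'
    have hj := congrFun hc j
    have hk := congrFun hc k
    rw [Pi.smul_apply, pointOnLine_mid hij, pointOnLine_mid hij, smul_eq_mul, mul_one] at hj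
    rw [Pi.smul_apply, pointOnLine_right hik hjk, pointOnLine_right hik hjk, hj, one_smul] at hk
    exact hk.symm

end

/-! ### Divisibility by linear forms, and the logarithmic condition -/

/-- The linear form `x_i - ζ x_j`. -/
noncomputable def lineForm (i j : Fin 3) (ζ : ℂ) : MvPolynomial (Fin 3) ℂ :=
  X i - C ζ * X j

theorem eval_lineForm (i j : Fin 3) (ζ : ℂ) (v : Fin 3 → ℂ) :
    eval v (lineForm i j ζ) = v i - ζ * v j := by
  simp [lineForm]

theorem lineForm_ne_zero {i j : Fin 3} (hij : i ≠ j) (ζ : ℂ) : lineForm i j ζ ≠ 0 := by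
  intro h
  have := congrArg (eval (Pi.single i 1)) h
  simp [eval_lineForm, hij.symm] at this

/-- Modulo the form, `X i` equals `ζ X j`, so the substitution does not change the residue class.
Hence a polynomial killed by the substitution is divisible by the form. -/
theorem lineForm_dvd_sub {i j : Fin 3} (ζ : ℂ) (g : MvPolynomial (Fin 3) ℂ) :
    lineForm i j ζ ∣ g - aeval (Function.update X i (C ζ * X j)) g := by
  rw [← Ideal.mem_span_singleton, ← Ideal.Quotient.eq]
  have : (Ideal.Quotient.mkₐ ℂ (Ideal.span {lineForm i j ζ})) =
      (Ideal.Quotient.mkₐ ℂ (Ideal.span {lineForm i j ζ})).comp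
        (aeval (Function.update X i (C ζ * X j))) := by
    apply MvPolynomial.algHom_ext
    intro a
    rw [AlgHom.comp_apply, aeval_X]
    by_cases ha : a = i
    · subst ha
      rw [Function.update_self, Ideal.Quotient.mkₐ_eq_mk, Ideal.Quotient.eq]
      exact Ideal.mem_span_singleton_self _
    · rw [Function.update_of_ne ha]
  exact DFunLike.congr_fun this g

theorem lineForm_dvd_iff {i j : Fin 3} (hij : i ≠ j) {ζ : ℂ} {g : MvPolynomial (Fin 3) ℂ} :
    lineForm i j ζ ∣ g ↔ ∀ v : Fin 3 → ℂ, v i = ζ * v j → eval v g = 0 := by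
  constructor
  · rintro ⟨h, rfl⟩ v hv
    rw [map_mul, eval_lineForm, hv, sub_self, zero_mul]
  · intro h
    have h0 : aeval (Function.update X i (C ζ * X j)) g = (0 : MvPolynomial (Fin 3) ℂ) := by
      apply MvPolynomial.funext
      intro v
      rw [map_zero, ← h (Function.update v i (ζ * v j)) (by simp [hij.symm]),
        aeval_def, algebraMap_eq, eval_eval₂]
      have h1 : (eval v).comp C = RingHom.id ℂ := by ext; simp
      have h2 : (fun s => eval v ((Function.update X i (C ζ * X j) : Fin 3 → _) s)) =
          Function.update v i (ζ * v j) := by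
        funext s
        by_cases hs : s = i
        · subst hs; simp
        · simp [hs]
      rw [h1, h2]
      rfl
    have := lineForm_dvd_sub (i := i) (j := j) ζ g
    rwa [h0, sub_zero] at this

/-- The form generates the kernel of the substitution `X i ↦ ζ X j`, whose target is a domain. -/
theorem prime_lineForm {i j : Fin 3} (hij : i ≠ j) (ζ : ℂ) : Prime (lineForm i j ζ) := by
  refine ⟨lineForm_ne_zero hij ζ, fun h => ?_, fun a b hab => ?_⟩
  · have := (lineForm_dvd_iff hij).1 (h.dvd (a := 1)) 0 (by simp)
    simp at this
  · obtain ⟨c, hc⟩ := hab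
    have h0 : aeval (Function.update X i (C ζ * X j)) (lineForm i j ζ) =
        (0 : MvPolynomial (Fin 3) ℂ) := by
      simp [lineForm, hij.symm, algebraMap_eq]
    have h1 := congrArg (aeval (Function.update X i (C ζ * X j) : Fin 3 → MvPolynomial _ ℂ)) hc
    rw [map_mul, map_mul, h0, zero_mul] at h1
    refine (mul_eq_zero.1 h1).imp (fun h => ?_) fun h => ?_
    · have := lineForm_dvd_sub (i := i) (j := j) ζ a
      rwa [h, sub_zero] at this
    · have := lineForm_dvd_sub (i := i) (j := j) ζ b
      rwa [h, sub_zero] at this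

theorem fermatLine_eq_of_lineForm_dvd {i j a b : Fin 3} (hij : i ≠ j) (hab : a ≠ b) {ζ ω : ℂ}
    (h : lineForm i j ζ ∣ lineForm a b ω) : fermatLine i j ζ = fermatLine a b ω := by
  refine Submodule.eq_of_le_of_finrank_eq (fun v hv => ?_)
    ((finrank_fermatLine hij ζ).trans (finrank_fermatLine hab ω).symm)
  have := (lineForm_dvd_iff hij).1 h v (mem_fermatLine.1 hv)
  rw [eval_lineForm] at this
  exact mem_fermatLine.2 (sub_eq_zero.1 this)

/-- The condition in the definition of `D(A)` at the line `x_i = ζ x_j` can be tested on the form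
`x_i - ζ x_j`. -/
theorem forall_linearFormPoly_dvd_iff {i j : Fin 3} (hij : i ≠ j) {ζ : ℂ}
    (θ : Derivation ℂ (MvPolynomial (Fin 3) ℂ) (MvPolynomial (Fin 3) ℂ)) :
    (∀ a : Fin 3 → ℂ, (∀ v, v ∈ fermatLine i j ζ ↔ ∑ s, a s * v s = 0) →
      linearFormPoly a ∣ θ (linearFormPoly a)) ↔
    lineForm i j ζ ∣ θ (X i) - C ζ * θ (X j) := by
  have hθ : θ (lineForm i j ζ) = θ (X i) - C ζ * θ (X j) := by
    rw [lineForm, map_sub, ← smul_eq_C_mul, ← smul_eq_C_mul, θ.map_smul]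
  rw [← hθ]
  constructor
  · intro h
    have hs : ∀ v : Fin 3 → ℂ, ∑ s, (Pi.single i 1 - Pi.single j ζ : Fin 3 → ℂ) s * v s =
        v i - ζ * v j := by
      intro v
      simp [sub_mul, Finset.sum_sub_distrib, Pi.single_apply]
    have hf : linearFormPoly (Pi.single i 1 - Pi.single j ζ) = lineForm i j ζ := by
      apply MvPolynomial.funext
      intro v
      rw [eval_lineForm, ← hs v]
      simp [linearFormPoly]
    rw [← hf]
    exact h _ fun v => by rw [mem_fermatLine, hs, sub_eq_zero]
  · intro h a ha
    -- Test vectors on the line determine `a` up to the factor `a i`: first `(ζ, 1)` at the places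
    -- `i`, `j`, then the remaining coordinate vector.
    have hj : a j = -ζ * a i := by
      have := (ha (Function.update (Pi.single j 1) i ζ)).1 (mem_fermatLine.2 (by simp [hij.symm]))
      have e : ∑ s, a s * (Function.update (Pi.single j 1) i ζ : Fin 3 → ℂ) s =
          a i * ζ + a j := by
        rw [← Finset.add_sum_erase _ _ (Finset.mem_univ i)]
        congr 1
        · simp
        · rw [Finset.sum_eq_single j]
          · simp [hij.symm]
          · intro s hs hsj
            rw [Function.update_of_ne (Finset.ne_of_mem_erase hs), Pi.single_eq_of_ne hsj, mul_zero]
          · intro hj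
            exact (hj (Finset.mem_erase.2 ⟨hij.symm, Finset.mem_univ j⟩)).elim
      rw [e] at this
      linear_combination this
    have hk : ∀ s, s ≠ i → s ≠ j → a s = 0 := by
      intro s hi hj
      have := (ha (Pi.single s 1)).1 (mem_fermatLine.2 (by simp [hi.symm, hj.symm]))
      simpa [Pi.single_apply] using this
    have hf : linearFormPoly a = a i • lineForm i j ζ := by
      have e : a = Pi.single i (a i) + Pi.single j (-ζ * a i) := by
        funext s
        by_cases hi : s = i
        · subst hi; simp [hij]
        · by_cases h' : s = j
          · subst h'; simp [hij.symm, hj]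
          · simp [hi, h', hk s hi h']
      apply MvPolynomial.funext
      intro v
      rw [smul_eval, eval_lineForm, linearFormPoly]
      conv_lhs => rw [e]
      simp [add_mul, Finset.sum_add_distrib, Pi.single_apply]
      ring
    rw [hf, θ.map_smul, smul_eq_C_mul, smul_eq_C_mul]
    exact mul_dvd_mul_left _ h

theorem lineForm_dvd_of_mem_logDerivations {A : LineArrangement ℂ} {i j : Fin 3} (hij : i ≠ j)
    {ζ : ℂ} (hL : fermatLine i j ζ ∈ A.lines)
    {θ : Derivation ℂ (MvPolynomial (Fin 3) ℂ) (MvPolynomial (Fin 3) ℂ)}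
    (hθ : θ ∈ A.logDerivations) : lineForm i j ζ ∣ θ (X i) - C ζ * θ (X j) :=
  (forall_linearFormPoly_dvd_iff hij θ).1 (hθ _ hL)

theorem mem_logDerivations_fermatArrangement
    {θ : Derivation ℂ (MvPolynomial (Fin 3) ℂ) (MvPolynomial (Fin 3) ℂ)}
    (h : ∀ (i j : Fin 3) (ζ : ℂ), i ≠ j → ζ ^ 4 = 1 → lineForm i j ζ ∣ θ (X i) - C ζ * θ (X j)) :
    θ ∈ fermatArrangement.logDerivations := by
  intro L hL
  obtain ⟨i, j, ζ, hij, hζ, rfl⟩ := mem_fermatArrangement.1 hL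
  exact (forall_linearFormPoly_dvd_iff hij θ).2 (h i j ζ hij hζ)

/-! ### Saito's criterion and freeness -/

/-- The coefficients of derivations `θ₀, θ₁, θ₂`, as a matrix. -/
noncomputable def coeffMatrix
    (θ : Fin 3 → Derivation ℂ (MvPolynomial (Fin 3) ℂ) (MvPolynomial (Fin 3) ℂ)) :
    Matrix (Fin 3) (Fin 3) (MvPolynomial (Fin 3) ℂ) :=
  Matrix.of fun r c => θ r (X c)

/-- The homogeneous basis of `D(A)` for the arrangement `(x⁴ - y⁴)(y⁴ - z⁴)(x⁴ - z⁴) = 0`. -/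
noncomputable def fermatDerivation (r : Fin 3) :
    Derivation ℂ (MvPolynomial (Fin 3) ℂ) (MvPolynomial (Fin 3) ℂ) :=
  mkDerivation ℂ ((![fun c => X c, fun c => X c ^ 5, fun c => (X (c + 1) * X (c + 2)) ^ 3] :
    Fin 3 → Fin 3 → MvPolynomial (Fin 3) ℂ) r)

theorem fermatDerivation_mem (r : Fin 3) :
    fermatDerivation r ∈ fermatArrangement.logDerivations := by
  refine mem_logDerivations_fermatArrangement fun i j ζ hij hζ => ?_
  rw [lineForm_dvd_iff hij]
  intro v hv
  fin_cases r
  · simp [fermatDerivation, mkDerivation_X, hv]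
  · simp only [fermatDerivation, mkDerivation_X]
    simp [hv]
    linear_combination (ζ * v j ^ 5) * hζ
  · simp only [fermatDerivation, mkDerivation_X]
    fin_cases i <;> fin_cases j <;> first | exact (hij rfl).elim | skip
    all_goals
      simp at hv ⊢
      simp only [hv]
      first
      | linear_combination (-(v 0) ^ 3 * v 1 ^ 3) * hζ
      | linear_combination (-(v 0) ^ 3 * v 2 ^ 3) * hζ
      | linear_combination (-(v 1) ^ 3 * v 2 ^ 3) * hζ

theorem isHomogeneousDerivation_fermatDerivation (r : Fin 3) :
    IsHomogeneousDerivation (fermatDerivation r) (![1, 5, 6] r) := by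
  intro i
  fin_cases r
  · simpa [fermatDerivation, mkDerivation_X] using isHomogeneous_X ℂ i
  · simpa [fermatDerivation, mkDerivation_X] using isHomogeneous_X_pow (R := ℂ) i 5
  · simpa [fermatDerivation, mkDerivation_X] using
      ((isHomogeneous_X ℂ (i + 1)).mul (isHomogeneous_X ℂ (i + 2))).pow 3

theorem prod_lineForm (i j : Fin 3) :
    ∏ n : Fin 4, lineForm i j (Complex.I ^ (n : ℕ)) = X i ^ 4 - X j ^ 4 := by
  have hI : (C Complex.I : MvPolynomial (Fin 3) ℂ) ^ 2 = -1 := by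
    rw [← map_pow, Complex.I_sq, map_neg, map_one]
  have hI3 : (C Complex.I : MvPolynomial (Fin 3) ℂ) ^ 3 = -C Complex.I := by
    rw [pow_succ, hI, neg_one_mul]
  simp only [Fin.prod_univ_four, lineForm, map_pow, Fin.val_zero, Fin.val_one, Fin.val_two,
    show ((3 : Fin 4) : ℕ) = 3 from rfl, hI, hI3]
  linear_combination (-(X i ^ 2 - X j ^ 2) * X j ^ 2) * hI

/-- The cyclic indexing gives the last factor as `z⁴ - x⁴`, so the product is the defining
polynomial up to sign. -/
theorem det_coeffMatrix_fermatDerivation :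
    (coeffMatrix fermatDerivation).det =
      ∏ p : Fin 3 × Fin 4, lineForm p.1 (p.1 + 1) (Complex.I ^ (p.2 : ℕ)) := by
  rw [Fintype.prod_prod_type]
  simp only [prod_lineForm]
  rw [Matrix.det_fin_three, Fin.prod_univ_three]
  simp [coeffMatrix, fermatDerivation, mkDerivation_X]
  ring

theorem det_coeffMatrix_fermatDerivation_ne_zero : (coeffMatrix fermatDerivation).det ≠ 0 := by
  have hs : ∀ a : Fin 3, a ≠ a + 1 := by decide
  rw [det_coeffMatrix_fermatDerivation, Finset.prod_ne_zero_iff]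
  exact fun p _ => lineForm_ne_zero (hs p.1) _

/-- At every point of the line, the vector `e_i - ζ e_j` is in the kernel of the evaluated matrix,
so the determinant vanishes on the line. -/
theorem lineForm_dvd_det {i j : Fin 3} (hij : i ≠ j) {ζ : ℂ}
    {N : Matrix (Fin 3) (Fin 3) (MvPolynomial (Fin 3) ℂ)}
    (h : ∀ r, lineForm i j ζ ∣ N r i - C ζ * N r j) : lineForm i j ζ ∣ N.det := by
  rw [lineForm_dvd_iff hij]
  intro v hv
  rw [RingHom.map_det, ← Matrix.exists_mulVec_eq_zero_iff]
  refine ⟨Pi.single i 1 - Pi.single j ζ, fun h0 => ?_, ?_⟩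
  · have := congrFun h0 i
    simp [hij] at this
  · funext r
    have := (lineForm_dvd_iff hij).1 (h r) v hv
    simp only [map_sub, map_mul, eval_C] at this
    simp [Matrix.mulVec_sub]
    linear_combination this

/-- Saito's divisibility: three logarithmic vector fields have determinant divisible by the
defining polynomial. -/
theorem det_dvd_det_coeffMatrix
    {θ : Fin 3 → Derivation ℂ (MvPolynomial (Fin 3) ℂ) (MvPolynomial (Fin 3) ℂ)}
    (hθ : ∀ r, θ r ∈ fermatArrangement.logDerivations) :
    (coeffMatrix fermatDerivation).det ∣ (coeffMatrix θ).det := by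
  have hs : ∀ a : Fin 3, a ≠ a + 1 := by decide
  rw [det_coeffMatrix_fermatDerivation]
  refine Finset.prod_dvd_of_isRelPrime ?_ ?_
  · intro p _ q _ hpq
    change IsRelPrime _ _
    rw [(prime_lineForm (hs p.1) _).irreducible.isRelPrime_iff_not_dvd]
    exact fun h => hpq (cyclicLine_injective (fermatLine_eq_of_lineForm_dvd (hs _) (hs _) h))
  · intro p _
    exact lineForm_dvd_det (hs p.1) fun r =>
      lineForm_dvd_of_mem_logDerivations (hs p.1) (Set.mem_range_self p) (hθ r)

/-- Cramer's rule. -/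
theorem exists_vecMul_eq_of_det_dvd {R n : Type*} [CommRing R] [IsDomain R] [Fintype n]
    [DecidableEq n] {M : Matrix n n R} (hM : M.det ≠ 0) {f : n → R}
    (h : ∀ j, M.det ∣ (M.updateRow j f).det) : ∃ c : n → R, Matrix.vecMul c M = f := by
  choose c hc using h
  refine ⟨c, ?_⟩
  have h1 : M.det • c = Matrix.vecMul f M.adjugate := by
    funext j
    rw [Pi.smul_apply, smul_eq_mul, ← hc, ← Matrix.cramer_transpose_apply,
      Matrix.cramer_eq_adjugate_mulVec, ← Matrix.adjugate_transpose, Matrix.mulVec_transpose]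
  have h2 : M.det • Matrix.vecMul c M = M.det • f := by
    rw [← Matrix.smul_vecMul, h1, Matrix.vecMul_vecMul, Matrix.adjugate_mul, Matrix.vecMul_smul,
      Matrix.vecMul_one]
  exact smul_right_injective _ hM h2

theorem exists_eq_sum_fermatDerivation
    {η : Derivation ℂ (MvPolynomial (Fin 3) ℂ) (MvPolynomial (Fin 3) ℂ)}
    (hη : η ∈ fermatArrangement.logDerivations) :
    ∃ c : Fin 3 → MvPolynomial (Fin 3) ℂ, η = ∑ r, c r • fermatDerivation r := by
  obtain ⟨c, hc⟩ := exists_vecMul_eq_of_det_dvd (f := fun a => η (X a))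
    det_coeffMatrix_fermatDerivation_ne_zero (fun j => by
      -- The determinants in Cramer's rule are those of three logarithmic fields, with `η` replacing
      -- one basis member, so Saito's divisibility applies.
      have e : (coeffMatrix fermatDerivation).updateRow j (fun a => η (X a)) =
          coeffMatrix (Function.update fermatDerivation j η) := by
        ext r a : 1
        by_cases hr : r = j
        · subst hr; simp [coeffMatrix]
        · simp [coeffMatrix, hr]
      rw [e]
      refine det_dvd_det_coeffMatrix fun r => ?_
      by_cases hr : r = j
      · subst hr; simpa using hη
      · simpa [hr] using fermatDerivation_mem r)
  refine ⟨c, derivation_ext fun a => ?_⟩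
  have := congrFun hc a
  simp only [Matrix.vecMul, dotProduct, coeffMatrix, Matrix.of_apply] at this
  rw [← this]
  simp [Fin.sum_univ_three]

theorem fermatArrangement_isFreeWithExponents :
    fermatArrangement.IsFreeWithExponents 5 6 := by
  let v : Fin 3 → fermatArrangement.logDerivations := fun r =>
    ⟨fermatDerivation r, fermatDerivation_mem r⟩
  have hli : LinearIndependent (MvPolynomial (Fin 3) ℂ) v := by
    refine Fintype.linearIndependent_iffₛ.2 fun f g hfg => ?_
    have h0 : ∀ c : Fin 3 → MvPolynomial (Fin 3) ℂ,
        Matrix.vecMul c (coeffMatrix fermatDerivation) =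
          fun a => (∑ r, c r • v r : fermatArrangement.logDerivations).1 (X a) := by
      intro c
      funext a
      simp [v, Matrix.vecMul, dotProduct, coeffMatrix, Fin.sum_univ_three]
    have h1 : Matrix.vecMul (f - g) (coeffMatrix fermatDerivation) = 0 := by
      rw [Matrix.sub_vecMul, h0 f, h0 g, hfg, sub_self]
    exact congrFun (sub_eq_zero.1
      (Matrix.eq_zero_of_vecMul_eq_zero det_coeffMatrix_fermatDerivation_ne_zero h1))
  have hsp : ⊤ ≤ Submodule.span (MvPolynomial (Fin 3) ℂ) (Set.range v) := by
    rintro ⟨η, hη⟩ -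
    obtain ⟨c, hc⟩ := exists_eq_sum_fermatDerivation hη
    have : (⟨η, hη⟩ : fermatArrangement.logDerivations) = ∑ r, c r • v r := by
      apply Subtype.ext
      simpa [v] using hc
    rw [this]
    exact Submodule.sum_mem _ fun r _ =>
      Submodule.smul_mem _ _ (Submodule.subset_span (Set.mem_range_self r))
  refine ⟨Module.Basis.mk hli hsp, ?_, ?_, ?_⟩
  · rw [Module.Basis.mk_apply]
    rfl
  · rw [Module.Basis.mk_apply]
    exact isHomogeneousDerivation_fermatDerivation 1
  · rw [Module.Basis.mk_apply]
    exact isHomogeneousDerivation_fermatDerivation 2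

/-! ### Low-degree logarithmic fields of a deletion -/

section
variable {i j k : Fin 3} {ζ : ℂ}

/-- Along the parametrized line `s ↦ (ω s, s, t)`, the linear coefficient of a polynomial is an
affine function of `ω`, and the constant coefficient does not depend on `ω`. -/
theorem exists_coeff_aeval_line (i j : Fin 3) (t : ℂ) (f : MvPolynomial (Fin 3) ℂ) :
    ∃ A B D : ℂ, ∀ ω : ℂ,
      (aeval (fun a => if a = i then Polynomial.C ω * Polynomial.X else
        if a = j then Polynomial.X else Polynomial.C t) f).coeff 0 = A ∧
      (aeval (fun a => if a = i then Polynomial.C ω * Polynomial.X else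
        if a = j then Polynomial.X else Polynomial.C t) f).coeff 1 = ω * B + D := by
  induction f using MvPolynomial.induction_on with
  | C c =>
    refine ⟨c, 0, 0, fun ω => ⟨?_, ?_⟩⟩
    · rw [aeval_C]
      simp
    · rw [aeval_C]
      simp
  | add p q hp hq =>
    obtain ⟨A, B, D, h⟩ := hp
    obtain ⟨A', B', D', h'⟩ := hq
    refine ⟨A + A', B + B', D + D', fun ω => ⟨?_, ?_⟩⟩
    · rw [map_add, Polynomial.coeff_add, (h ω).1, (h' ω).1]
    · rw [map_add, Polynomial.coeff_add, (h ω).2, (h' ω).2]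
      ring
  | mul_X p n hp =>
    obtain ⟨A, B, D, h⟩ := hp
    refine ⟨A * (if n = i then 0 else if n = j then 0 else t),
      B * (if n = i then 0 else if n = j then 0 else t) + A * (if n = i then 1 else 0),
      D * (if n = i then 0 else if n = j then 0 else t) +
        A * (if n = i then 0 else if n = j then 1 else 0), fun ω => ⟨?_, ?_⟩⟩
    · rw [map_mul, aeval_X, Polynomial.mul_coeff_zero, (h ω).1]
      split_ifs <;> simp
    · rw [map_mul, aeval_X, Polynomial.mul_coeff_one, (h ω).1, (h ω).2]
      split_ifs <;> simp [Polynomial.coeff_C] <;> ring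

/-- A logarithmic vector field of degree at most five of the deletion is logarithmic along the
deleted line: its contraction with the form of that line, restricted to the line, has a double
zero at the quadruple point and vanishes at the four triple points. -/
theorem lineForm_dvd_of_mem_delete (hij : i ≠ j) (hik : i ≠ k) (hjk : j ≠ k) (hζ : ζ ^ 4 = 1)
    {η : Derivation ℂ (MvPolynomial (Fin 3) ℂ) (MvPolynomial (Fin 3) ℂ)}
    (hη : η ∈ (fermatArrangement.delete (fermatLine i j ζ)).logDerivations)
    (hd : ∀ a, (η (X a)).totalDegree ≤ 5) :
    lineForm i j ζ ∣ η (X i) - C ζ * η (X j) := by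
  have hζ0 := ne_zero_of_pow_four_eq_one hζ
  -- The extra factor `X k`, prime to the form, reduces the check to points of the line with `v k ≠
  -- 0`.
  suffices h : lineForm i j ζ ∣ (η (X i) - C ζ * η (X j)) * X k by
    refine ((prime_lineForm hij ζ).dvd_or_dvd h).resolve_right fun h' => ?_
    have := (lineForm_dvd_iff hij).1 h' (pointOnLine i j ζ 1)
      (by rw [pointOnLine_left, pointOnLine_mid hij, mul_one])
    rw [eval_X, pointOnLine_right hik hjk] at this
    exact one_ne_zero this
  rw [lineForm_dvd_iff hij]
  intro v hv
  rw [map_mul, eval_X]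
  by_cases ht : v k = 0
  · rw [ht, mul_zero]
  refine mul_eq_zero_of_left ?_ _
  set t := v k
  set γ : ℂ → Fin 3 → Polynomial ℂ := fun ω a => if a = i then Polynomial.C ω * Polynomial.X else
    if a = j then Polynomial.X else Polynomial.C t with hγ
  have hγi : ∀ ω, γ ω i = Polynomial.C ω * Polynomial.X := fun ω => by simp [hγ]
  have hγj : ∀ ω, γ ω j = Polynomial.X := fun ω => by simp [hγ, hij.symm]
  have hγk : ∀ ω, γ ω k = Polynomial.C t := fun ω => by simp [hγ, hik.symm, hjk.symm]
  have hev : ∀ (ω s : ℂ) (f : MvPolynomial (Fin 3) ℂ),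
      (aeval (γ ω) f).eval s = eval (fun a => (γ ω a).eval s) f := by
    intro ω s f
    rw [← Polynomial.coe_evalRingHom, aeval_def, hom_eval₂]
    have : (Polynomial.evalRingHom s).comp (algebraMap ℂ (Polynomial ℂ)) = RingHom.id ℂ := by
      ext; simp
    rw [this]
    rfl
  obtain ⟨A, B, D, hf⟩ := exists_coeff_aeval_line i j t (η (X i))
  obtain ⟨A', B', D', hg⟩ := exists_coeff_aeval_line i j t (η (X j))
  -- `p ω` is the contraction of `η` with `x_i - ω x_j` along the line `x_i = ω x_j`, in the affine
  -- parameter `s ↦ (ω s, s, t)`; `s = 0` is the quadruple point. It vanishes identically for the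
  -- three surviving parameters.
  set p : ℂ → Polynomial ℂ := fun ω => aeval (γ ω) (η (X i)) - Polynomial.C ω *
    aeval (γ ω) (η (X j)) with hp
  have hp0 : ∀ ω, (p ω).coeff 0 = A - ω * A' := fun ω => by
    rw [hp, Polynomial.coeff_sub, Polynomial.coeff_C_mul, (hf ω).1, (hg ω).1]
  have hp1 : ∀ ω, (p ω).coeff 1 = ω * B + D - ω * (ω * B' + D') := fun ω => by
    rw [hp, Polynomial.coeff_sub, Polynomial.coeff_C_mul, (hf ω).2, (hg ω).2]
  have hpω : ∀ c : ℂ, c ^ 4 = 1 → c ≠ 1 → p (c * ζ) = 0 := by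
    intro c hc hne
    have hm := lineForm_dvd_of_mem_logDerivations hij
      (fermatLine_mem_delete_same (ζ := ζ) (ω := c * ζ) hij (by rw [mul_pow, hc, hζ, one_mul])
        fun e => hne (mul_right_cancel₀ hζ0 (e.trans (one_mul ζ).symm))) hη
    obtain ⟨q, hq⟩ := hm
    have h1 := congrArg (aeval (γ (c * ζ))) hq
    have h2 : aeval (γ (c * ζ)) (lineForm i j (c * ζ)) = 0 := by
      rw [lineForm, map_sub, map_mul, aeval_X, aeval_X, hγi, hγj, aeval_C]
      exact sub_self _
    rw [map_mul _ (lineForm i j (c * ζ)), h2, zero_mul, map_sub, map_mul _ (C (c * ζ)),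
      aeval_C] at h1
    exact h1
  have hI : Complex.I ^ 4 = 1 := Complex.I_pow_four
  have hI2 := Complex.I_sq
  have p1 := hpω Complex.I hI fun h => by simpa using congrArg Complex.im h
  have p2 := hpω (-1) (by norm_num) (by norm_num)
  have p3 := hpω (-Complex.I) (by rw [Even.neg_pow (by decide), hI])
    fun h => by simpa using congrArg Complex.im h
  -- The coefficients of `1` and `s` in `p ω` are polynomials in `ω` of degree at most 1 and 2. Both
  -- vanish at the three values `Iζ`, `-ζ`, `-Iζ`, hence also at `ζ`.
  have c0 : (p ζ).coeff 0 = 0 := by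
    have e1 := hp0 (Complex.I * ζ)
    have e3 := hp0 (-Complex.I * ζ)
    have e2 := hp0 (-1 * ζ)
    rw [p1, Polynomial.coeff_zero] at e1
    rw [p2, Polynomial.coeff_zero] at e2
    rw [p3, Polynomial.coeff_zero] at e3
    rw [hp0]
    linear_combination -e1 - e3 + e2
  have c1 : (p ζ).coeff 1 = 0 := by
    have e1 := hp1 (Complex.I * ζ)
    have e3 := hp1 (-Complex.I * ζ)
    have e2 := hp1 (-1 * ζ)
    rw [p1, Polynomial.coeff_zero] at e1
    rw [p2, Polynomial.coeff_zero] at e2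
    rw [p3, Polynomial.coeff_zero] at e3
    rw [hp1]
    have f1 : 2 * (Complex.I * ζ) * (B - D') = 0 := by linear_combination e3 - e1
    have f2 : B - D' = 0 := (mul_eq_zero.1 f1).resolve_left
      (mul_ne_zero two_ne_zero (mul_ne_zero Complex.I_ne_zero hζ0))
    linear_combination -e2 + 2 * ζ * f2
  obtain ⟨q, hq⟩ : Polynomial.X ^ 2 ∣ p ζ := by
    rw [Polynomial.X_pow_dvd_iff]
    intro d hd2
    interval_cases d
    exacts [c0, c1]
  have hdeg : ∀ f : MvPolynomial (Fin 3) ℂ, f.totalDegree ≤ 5 →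
      (aeval (γ ζ) f).natDegree ≤ 5 := by
    intro f h5
    refine aeval_natDegree_le f h5 _ (n := 1) fun a => ?_
    simp only [hγ]
    split_ifs
    · exact (Polynomial.natDegree_C_mul_le _ _).trans Polynomial.natDegree_X_le
    · exact Polynomial.natDegree_X_le
    · simp
  have hpdeg : (p ζ).natDegree ≤ 5 :=
    (Polynomial.natDegree_sub_le_of_le (hdeg _ (hd i))
      ((Polynomial.natDegree_C_mul_le _ _).trans (hdeg _ (hd j)))).trans (by simp)
  -- At the triple point `(ζωt, ωt, t)` the two other lines survive, and `η_i - ζ η_j = (η_i - ζω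
  -- η_k) - ζ (η_j - ω η_k)`.
  have hroot : ∀ n : Fin 4, (p ζ).eval (Complex.I ^ (n : ℕ) * t) = 0 := by
    intro n
    have hω := I_pow_pow_four n
    generalize Complex.I ^ (n : ℕ) = ω at hω ⊢
    have h1 := (lineForm_dvd_iff hik).1 (lineForm_dvd_of_mem_logDerivations hik
      (fermatLine_mem_delete_left hik hjk (ω := ζ * ω) (by rw [mul_pow, hζ, hω, one_mul])) hη)
      (fun a => (γ ζ a).eval (ω * t)) (by rw [hγi, hγk]; simp [mul_assoc])
    have h2 := (lineForm_dvd_iff hjk).1 (lineForm_dvd_of_mem_logDerivations hjk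
      (fermatLine_mem_delete_right hik hjk hω) hη)
      (fun a => (γ ζ a).eval (ω * t)) (by rw [hγj, hγk]; simp)
    rw [map_sub, map_mul, eval_C] at h1 h2
    rw [hp, Polynomial.eval_sub, Polynomial.eval_mul, Polynomial.eval_C, hev, hev]
    linear_combination h1 - ζ * h2
  -- After removal of `X ^ 2` the degree is at most 3, while four distinct nonzero roots remain.
  have hq0 : q = 0 := by
    by_contra hne
    refine hne (Polynomial.eq_zero_of_natDegree_lt_card_of_eval_eq_zero q
      (f := fun n : Fin 4 => Complex.I ^ (n : ℕ) * t)
      (fun m n h => I_pow_injective (mul_right_cancel₀ ht h)) (fun n => ?_) ?_)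
    · have := hroot n
      rw [hq, Polynomial.eval_mul, Polynomial.eval_pow, Polynomial.eval_X] at this
      exact (mul_eq_zero.1 this).resolve_left
        (pow_ne_zero 2 (mul_ne_zero (pow_ne_zero _ Complex.I_ne_zero) ht))
    · rw [hq, Polynomial.natDegree_mul (pow_ne_zero 2 Polynomial.X_ne_zero) hne,
        Polynomial.natDegree_X_pow] at hpdeg
      rw [Fintype.card_fin]
      omega
  have hpz : p ζ = 0 := by rw [hq, hq0, mul_zero]
  have hvv : v = fun a => (γ ζ a).eval (v j) := by
    funext a
    rcases eq_or_eq_or_eq hij hik hjk a with rfl | rfl | rfl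
    · rw [hγi, hv]; simp
    · rw [hγj]; simp
    · rw [hγk]; simp [t]
  have := congrArg (Polynomial.eval (v j)) hpz
  rw [hp, Polynomial.eval_sub, Polynomial.eval_mul, Polynomial.eval_C, hev, hev, ← hvv,
    Polynomial.eval_zero] at this
  rw [map_sub, map_mul, eval_C, this]

theorem mem_logDerivations_of_mem_delete (hij : i ≠ j)
    {η : Derivation ℂ (MvPolynomial (Fin 3) ℂ) (MvPolynomial (Fin 3) ℂ)}
    (hη : η ∈ (fermatArrangement.delete (fermatLine i j ζ)).logDerivations)
    (h : lineForm i j ζ ∣ η (X i) - C ζ * η (X j)) :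
    η ∈ fermatArrangement.logDerivations := by
  intro L hL
  by_cases hH : L = fermatLine i j ζ
  · subst hH
    exact (forall_linearFormPoly_dvd_iff hij η).2 h
  · exact hη L ⟨hL, hH⟩

/-- The deletion has logarithmic vector fields that are not logarithmic along the deleted line. -/
theorem exists_mem_delete_not_mem (hij : i ≠ j) (hik : i ≠ k) (hjk : j ≠ k) (hζ : ζ ^ 4 = 1) :
    ∃ η ∈ (fermatArrangement.delete (fermatLine i j ζ)).logDerivations,
      η ∉ fermatArrangement.logDerivations := by
  -- The field is `P ∂_i`, with `P` the product of the forms of all surviving lines whose equation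
  -- involves `x_i`; the cubic factor is `(x_i⁴ - x_j⁴) / (x_i - ζ x_j)`.
  set P : MvPolynomial (Fin 3) ℂ :=
    (X i ^ 3 + C ζ * X i ^ 2 * X j + C ζ ^ 2 * X i * X j ^ 2 + C ζ ^ 3 * X j ^ 3) *
      (X i ^ 4 - X k ^ 4) with hP
  have hPv : ∀ v : Fin 3 → ℂ, eval v P =
      (v i ^ 3 + ζ * v i ^ 2 * v j + ζ ^ 2 * v i * v j ^ 2 + ζ ^ 3 * v j ^ 3) *
      (v i ^ 4 - v k ^ 4) := by
    intro v
    simp [hP]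
  set η : Derivation ℂ (MvPolynomial (Fin 3) ℂ) (MvPolynomial (Fin 3) ℂ) :=
    mkDerivation ℂ (Pi.single i P) with hηd
  have hi : η (X i) = P := by rw [hηd, mkDerivation_X, Pi.single_eq_same]
  have hj : η (X j) = 0 := by rw [hηd, mkDerivation_X, Pi.single_eq_of_ne hij.symm]
  have hk : η (X k) = 0 := by rw [hηd, mkDerivation_X, Pi.single_eq_of_ne hik.symm]
  refine ⟨η, fun L hL => ?_, fun h => ?_⟩
  · obtain ⟨ω, hω, ⟨rfl, hne⟩ | rfl | rfl⟩ := (mem_delete_fermatLine hij hik hjk).1 hL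
    · rw [forall_linearFormPoly_dvd_iff hij, lineForm_dvd_iff hij, hi, hj, mul_zero, sub_zero]
      intro v hv
      rw [hPv]
      refine mul_eq_zero_of_left ?_ _
      refine (mul_eq_zero.1 (?_ : (ω - ζ) * _ = 0)).resolve_left (sub_ne_zero.2 hne)
      rw [hv]
      linear_combination (v j) ^ 3 * (hω - hζ)
    · rw [forall_linearFormPoly_dvd_iff hik, lineForm_dvd_iff hik, hi, hk, mul_zero, sub_zero]
      intro v hv
      rw [hPv, hv, mul_pow ω _ 4, hω, one_mul, sub_self, mul_zero]
    · rw [forall_linearFormPoly_dvd_iff hjk, hj, hk, mul_zero, sub_zero]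
      exact dvd_zero _
  · have h1 := lineForm_dvd_of_mem_logDerivations hij
      (mem_fermatArrangement.2 ⟨i, j, ζ, hij, hζ, rfl⟩) h
    rw [lineForm_dvd_iff hij, hi, hj, mul_zero, sub_zero] at h1
    -- The value 2 is not a fourth root of unity, so this point of the deleted line is on no other
    -- line; there `P = 4ζ³ (1 - 16) = -60 ζ³`.
    have h2 := h1 (pointOnLine i j ζ 2)
      (by rw [pointOnLine_left, pointOnLine_mid hij, mul_one])
    rw [hPv, pointOnLine_left, pointOnLine_mid hij, pointOnLine_right hik hjk, hζ] at h2
    have h3 : ζ ^ 3 = 0 := by linear_combination (-1 / 60) * h2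
    exact pow_ne_zero 3 (ne_zero_of_pow_four_eq_one hζ) h3

end

/-! ### Degrees of determinants -/

theorem isHomogeneous_det {N : Matrix (Fin 3) (Fin 3) (MvPolynomial (Fin 3) ℂ)} {d : Fin 3 → ℕ}
    (h : ∀ r c, (N r c).IsHomogeneous (d r)) : N.det.IsHomogeneous (d 0 + d 1 + d 2) := by
  rw [← Fin.sum_univ_three, Matrix.det_apply]
  refine IsHomogeneous.sum _ _ _ fun σ _ => ?_
  have h1 : (∏ i, N (σ i) i).IsHomogeneous (∑ i, d i) := by
    rw [← Equiv.sum_comp σ d]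
    exact IsHomogeneous.prod _ _ _ fun i _ => h (σ i) i
  rcases Int.units_eq_one_or (Equiv.Perm.sign σ) with e | e <;> rw [e]
  · rwa [one_smul]
  · rw [Units.neg_smul, one_smul]
    exact h1.neg

theorem coeffMatrix_isHomogeneous
    {θ : Fin 3 → Derivation ℂ (MvPolynomial (Fin 3) ℂ) (MvPolynomial (Fin 3) ℂ)} {d : Fin 3 → ℕ}
    (h : ∀ r, IsHomogeneousDerivation (θ r) (d r)) :
    (coeffMatrix θ).det.IsHomogeneous (d 0 + d 1 + d 2) :=
  isHomogeneous_det fun r c => h r c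

theorem totalDegree_det_coeffMatrix_fermatDerivation :
    (coeffMatrix fermatDerivation).det.totalDegree = 12 :=
  (coeffMatrix_isHomogeneous isHomogeneousDerivation_fermatDerivation).totalDegree
    det_coeffMatrix_fermatDerivation_ne_zero

theorem isHomogeneousDerivation_eulerDerivation :
    IsHomogeneousDerivation (eulerDerivation ℂ) 1 :=
  isHomogeneousDerivation_fermatDerivation 0

/-- Up to degree four, `D(A)` consists of multiples of the Euler derivation. -/
theorem crossProduct_eq_zero_of_degree_le_four
    {η : Derivation ℂ (MvPolynomial (Fin 3) ℂ) (MvPolynomial (Fin 3) ℂ)}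
    (hη : η ∈ fermatArrangement.logDerivations) {d : ℕ} (hd : IsHomogeneousDerivation η d)
    (hd4 : d ≤ 4) :
    crossProduct (fun a => eulerDerivation ℂ (X a)) (fun a => η (X a)) = 0 := by
  apply Matrix.eq_zero_of_mulVec_eq_zero det_coeffMatrix_fermatDerivation_ne_zero
  funext r
  -- The determinant is divisible by a polynomial of degree 12 but has degree at most `6 + 1 + 4 =
  -- 11`. As a triple product, it is entry `r` of the matrix applied to the cross product.
  have hdet : (coeffMatrix ![fermatDerivation r, eulerDerivation ℂ, η]).det = 0 := by
    by_contra hne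
    have hdvd : (coeffMatrix fermatDerivation).det ∣
        (coeffMatrix ![fermatDerivation r, eulerDerivation ℂ, η]).det :=
      det_dvd_det_coeffMatrix fun s => by
        fin_cases s
        exacts [fermatDerivation_mem r, fermatDerivation_mem 0, hη]
    have hhom : (coeffMatrix ![fermatDerivation r, eulerDerivation ℂ, η]).det.IsHomogeneous
        (![1, 5, 6] r + 1 + d) :=
      coeffMatrix_isHomogeneous (d := ![![1, 5, 6] r, 1, d]) fun s => by
        fin_cases s
        exacts [isHomogeneousDerivation_fermatDerivation r,
          isHomogeneousDerivation_eulerDerivation, hd]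
    have h1 := totalDegree_le_of_dvd_of_isDomain hdvd hne
    rw [totalDegree_det_coeffMatrix_fermatDerivation, hhom.totalDegree hne] at h1
    have h2 : (![1, 5, 6] : Fin 3 → ℕ) r ≤ 6 := by
      fin_cases r <;> decide
    omega
  have e : coeffMatrix ![fermatDerivation r, eulerDerivation ℂ, η] =
      ![fun a => fermatDerivation r (X a), fun a => eulerDerivation ℂ (X a), fun a => η (X a)] := by
    funext s a
    fin_cases s <;> rfl
  rw [e, ← triple_product_eq_det] at hdet
  exact hdet

/-! ### Non-freeness of the deletions -/

section
variable {i j k : Fin 3} {ζ : ℂ}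

theorem mem_of_mem_delete_of_degree_le_five (hij : i ≠ j) (hik : i ≠ k) (hjk : j ≠ k)
    (hζ : ζ ^ 4 = 1) {η : Derivation ℂ (MvPolynomial (Fin 3) ℂ) (MvPolynomial (Fin 3) ℂ)}
    (hη : η ∈ (fermatArrangement.delete (fermatLine i j ζ)).logDerivations) {d : ℕ}
    (hd : IsHomogeneousDerivation η d) (hd5 : d ≤ 5) :
    η ∈ fermatArrangement.logDerivations :=
  mem_logDerivations_of_mem_delete hij hη
    (lineForm_dvd_of_mem_delete hij hik hjk hζ hη fun a => (hd a).totalDegree_le.trans hd5)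

theorem logDerivations_le_delete (A : LineArrangement ℂ) (H : Submodule ℂ (Fin 3 → ℂ)) :
    A.logDerivations ≤ (A.delete H).logDerivations :=
  fun _ hη L hL => hη L hL.1

theorem not_isFree_delete (hij : i ≠ j) (hik : i ≠ k) (hjk : j ≠ k) (hζ : ζ ^ 4 = 1) :
    ¬ (fermatArrangement.delete (fermatLine i j ζ)).IsFree := by
  rintro ⟨d₂, d₃, b, hb0, hb1, hb2⟩
  set e : Fin 3 → Derivation ℂ (MvPolynomial (Fin 3) ℂ) (MvPolynomial (Fin 3) ℂ) :=
    fun r => (b r).1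
  have hsum : ∀ η (hη : η ∈ (fermatArrangement.delete (fermatLine i j ζ)).logDerivations),
      η = ∑ r, b.repr ⟨η, hη⟩ r • e r := by
    intro η hη
    have := congrArg Subtype.val (b.sum_repr ⟨η, hη⟩)
    rw [Submodule.coe_sum] at this
    exact this.symm
  have hall : ¬ ∀ r, e r ∈ fermatArrangement.logDerivations := by
    intro h
    obtain ⟨η, hη, hη'⟩ := exists_mem_delete_not_mem hij hik hjk hζ
    refine hη' ?_
    rw [hsum η hη]
    exact Submodule.sum_mem _ fun r _ => Submodule.smul_mem _ _ (h r)
  have h0 : e 0 ∈ fermatArrangement.logDerivations := by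
    rw [show e 0 = fermatDerivation 0 from hb0]
    exact fermatDerivation_mem 0
  have hsmall : ∀ r d, IsHomogeneousDerivation (e r) d → d ≤ 5 →
      e r ∈ fermatArrangement.logDerivations := fun r d hd hd5 =>
    mem_of_mem_delete_of_degree_le_five hij hik hjk hζ (b r).2 hd hd5
  -- `N` expresses the basis of `D(A)` in the supposed basis of the larger module; its determinant
  -- accounts for the difference of the degrees.
  obtain ⟨N, hN⟩ : ∃ N : Matrix (Fin 3) (Fin 3) (MvPolynomial (Fin 3) ℂ),
      coeffMatrix fermatDerivation = N * coeffMatrix e := by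
    refine ⟨Matrix.of fun r s => b.repr ⟨fermatDerivation r,
      logDerivations_le_delete _ _ (fermatDerivation_mem r)⟩ s, ?_⟩
    ext r a : 1
    have := congrArg (fun θ => θ (X a)) (hsum _
      (logDerivations_le_delete _ (fermatLine i j ζ) (fermatDerivation_mem r)))
    rw [Matrix.mul_apply]
    simpa [coeffMatrix, Fin.sum_univ_three] using this
  have hdet := congrArg Matrix.det hN
  rw [Matrix.det_mul] at hdet
  have hne := det_coeffMatrix_fermatDerivation_ne_zero
  rw [hdet] at hne
  obtain ⟨hN0, he0⟩ := mul_ne_zero_iff.1 hne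
  have hhom : (coeffMatrix e).det.IsHomogeneous (1 + d₂ + d₃) :=
    coeffMatrix_isHomogeneous (d := ![1, d₂, d₃]) fun s => by
      fin_cases s
      · change IsHomogeneousDerivation (e 0) 1
        rw [show e 0 = eulerDerivation ℂ from hb0]
        exact isHomogeneousDerivation_eulerDerivation
      exacts [hb1, hb2]
  have hdeg : N.det.totalDegree + (1 + d₂ + d₃) = 12 := by
    rw [← totalDegree_det_coeffMatrix_fermatDerivation, hdet,
      totalDegree_mul_of_isDomain hN0 he0, hhom.totalDegree he0]
  have hrows : coeffMatrix e = ![fun a => eulerDerivation ℂ (X a), fun a => e 1 (X a),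
      fun a => e 2 (X a)] := by
    funext s a
    fin_cases s
    · change e 0 (X a) = _
      rw [show e 0 = eulerDerivation ℂ from hb0]
      rfl
    all_goals rfl
  -- In degree at most 4 the field would lie in `D(A)` and be parallel to the Euler field, so the
  -- determinant of the basis would vanish.
  have h2 : 5 ≤ d₂ := by
    by_contra! hlt
    have hc := crossProduct_eq_zero_of_degree_le_four (hsmall 1 d₂ hb1 (by omega)) hb1 (by omega)
    apply he0
    rw [hrows, ← triple_product_eq_det, ← triple_product_permutation, hc, dotProduct_zero]
  have h3 : 5 ≤ d₃ := by
    by_contra! hlt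
    have hc := crossProduct_eq_zero_of_degree_le_four (hsmall 2 d₃ hb2 (by omega)) hb2 (by omega)
    apply he0
    rw [hrows, ← triple_product_eq_det, triple_product_permutation, ← cross_anticomm, hc,
      neg_zero, dotProduct_zero]
  -- Sum 10 forces `d₂ = d₃ = 5`, within reach of the degree-five lemma. Otherwise the sum is 11,
  -- `N.det` is a nonzero constant, and the adjugate of `N` expresses the basis through fields of
  -- `D(A)`.
  by_cases h5 : d₂ + d₃ = 10
  · refine hall fun r => ?_
    fin_cases r
    exacts [h0, hsmall 1 d₂ hb1 (by omega), hsmall 2 d₃ hb2 (by omega)]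
  · have hN1 : N.det.totalDegree = 0 := by omega
    rw [totalDegree_eq_zero_iff_eq_C] at hN1
    set c := N.det.coeff 0
    have hc : c ≠ 0 := by
      intro h
      rw [h, map_zero] at hN1
      exact hN0 hN1
    refine hall fun r => ?_
    have hadj : N.adjugate * coeffMatrix fermatDerivation = N.det • coeffMatrix e := by
      rw [hN, ← Matrix.mul_assoc, Matrix.adjugate_mul, Matrix.smul_mul, Matrix.one_mul]
    have her : e r = (C c⁻¹ : MvPolynomial (Fin 3) ℂ) • ∑ s, N.adjugate r s • fermatDerivation s := by
      refine derivation_ext fun a => ?_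
      have h1 := congrFun (congrFun hadj r) a
      rw [Matrix.mul_apply, hN1] at h1
      have hcc : (C c⁻¹ : MvPolynomial (Fin 3) ℂ) * C c = 1 := by
        rw [← C_mul, inv_mul_cancel₀ hc, C_1]
      simp only [coeffMatrix, Fin.sum_univ_three, Matrix.smul_apply, Matrix.of_apply,
        smul_eq_mul] at h1
      simp only [Fin.sum_univ_three, Derivation.smul_apply, Derivation.add_apply, smul_eq_mul]
      rw [h1, ← mul_assoc, hcc, one_mul]
    rw [her]
    exact Submodule.smul_mem _ _ (Submodule.sum_mem _ fun s _ =>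
      Submodule.smul_mem _ _ (fermatDerivation_mem s))

end

theorem proposition4p7 :
    ∃ A : LineArrangement ℂ,
      A.IsDefinedBy
        ((MvPolynomial.X 0 ^ 4 - MvPolynomial.X 1 ^ 4) *
          (MvPolynomial.X 1 ^ 4 - MvPolynomial.X 2 ^ 4) *
          (MvPolynomial.X 0 ^ 4 - MvPolynomial.X 2 ^ 4)) ∧
      A.lines.ncard = 12 ∧
      A.IsEssential ∧
      A.IsFreeWithExponents 5 6 ∧
      ∀ H ∈ A.lines,
        (A.delete H).lines.ncard = 11 ∧
        (A.delete H).IsEssential ∧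
        ¬ (A.delete H).IsFree ∧
        (A.delete H).n₂ = 4 ∧
        ((A.delete H).n₂ : ℝ) < ((A.lines.ncard : ℝ) - 1) / 2 := by
  refine ⟨fermatArrangement, fermatArrangement_isDefinedBy, ncard_fermatArrangement,
    fermatArrangement_isEssential, fermatArrangement_isFreeWithExponents, fun H hH => ?_⟩
  refine ⟨ncard_delete hH, ?_⟩
  obtain ⟨i, j, ζ, hij, hζ, rfl⟩ := mem_fermatArrangement.1 hH
  obtain ⟨k, hik, hjk⟩ : ∃ k, i ≠ k ∧ j ≠ k := by
    clear hH
    revert i j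
    decide
  refine ⟨delete_isEssential hij hik hjk, not_isFree_delete hij hik hjk hζ,
    n₂_delete hij hik hjk hζ, ?_⟩
  rw [n₂_delete hij hik hjk hζ, ncard_fermatArrangement]
  norm_num
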